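/- An MDP $\mathcal M=(S,S_\Box,S_\bigcirc,\to,P,r)$ consists of a countable set $S$ of states, partitioned into controlled states $S_\Box$ and random states $S_\bigcirc$, a transition relation $\to\,\subseteq S\times S$ in which every state has a successor, a map $P$ assigning to each random state a probability distribution over its successors, and a real reward $r(s,s')$ for each transition $s\to s'$. A strategy maps each partial run ending in a controlled state to a probability distribution over the successors of that state; a strategy and an initial state $s_0$ induce a probability measure on the runs $s_0s_1s_2\cdots$. For a run put $\limsup_{PP}=\limsup_n r(s_n,s_{n+1})$ and $\liminf_{PP}=\liminf_n r(s_n,s_{n+1})$. A strategy is optimal from $s_0$ for $\mathcal E(\limsup_{PP})$ if its expectation of $\limsup_{PP}$ from $s_0$ attains the supremum over all strategies, and optimal from $s_0$ for the threshold objective $\limsup_{PP}(\ge 0)$ if its probability of $\{\limsup_{PP}\ge 0\}$ from $s_0$ attains the supremum over all strategies; similarly for $\liminf$. A strategy class $C$ is $\mathrm{Rand}(\mathcal X)$ or $\mathrm{Det}(\mathcal X)$ for a family $\mathcal X$ of memory types: it contains the (for $\mathrm{Det}$: deterministic) strategies that, from $s_0$, can be implemented with a memory of a type in $\mathcal X$.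 Here a memory type is a countable set $\mathsf M$ of modes, with the allowed initial modes and the allowed one-step changes of the mode (no memory, finite memory, a step counter, a step counter plus one bit, etc.), and an implementation is an initial mode with a function $\tau:\mathsf M\times S\to\mathcal D(\mathsf M\times S)$ that respects the allowed changes of the mode, the relation $\to$ in controlled states, and $P$ in random states. **Theorem.** Let $\mathcal M$ be a countable MDP with bounded rewards and initial state $s_0$, and assume that an optimal strategy from $s_0$ for $\mathcal E(\limsup_{PP})$ (resp. $\mathcal E(\liminf_{PP})$) exists. Then there is an MDP $\mathcal M^u$, obtained from $\mathcal M$ by possibly removing some transitions (never one of positive probability from a random state) and replacing the reward function by a new one $u$, such that optimal strategies from $s_0$ for $\limsup_{PP}(\ge 0)$ (resp. $\liminf_{PP}(\ge 0)$) in $\mathcal M^u$ exist, and every such strategy, regarded as a strategy in $\mathcal M$, is optimal from $s_0$ for $\mathcal E(\limsup_{PP})$ (resp. $\mathcal E(\liminf_{PP})$) in $\mathcal M$. Therefore the strategy complexity of optimal $\mathcal E(\limsup_{PP})$ (resp. $\mathcal E(\liminf_{PP})$) is no greater than that of optimal $\limsup_{PP}(\ge 0)$ (resp. $\liminf_{PP}(\ge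 0)$), in the following sense. For every strategy class $C$: 1. if in the above $\mathcal M^u$ some strategy in $C$ is optimal from $s_0$ for the threshold objective, then in $\mathcal M$ some strategy in $C$ is optimal from $s_0$ for the expected objective; 2. for every countable set $S$: if in every MDP with state set $S$ and from every initial state, the existence of an optimal strategy for the threshold objective implies the existence of one in $C$, then in every MDP with state set $S$ and bounded rewards and from every initial state, the existence of an optimal strategy for the expected objective implies the existence of one in $C$. -/

import Mathlib

open MeasureTheory ProbabilityTheory Filter
open scoped ENNReal

noncomputable section

/-- A Markov decision process on the state set `S`.  A state is either controlled or random
(the random states are those outside `controlled`), `step` is the transition relation, and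
`prob s` is the distribution over the successors of the random state `s`.
Only the values of `reward` on pairs related by `step` are meaningful. -/
structure MDP (S : Type*) where
  controlled : Set S
  step : S → S → Prop
  exists_step : ∀ s, ∃ s', step s s'
  prob : {s : S // s ∉ controlled} → PMF S
  step_of_prob : ∀ s s', prob s s' ≠ 0 → step s s'
  reward : S → S → ℝ

namespace MDP

variable {S : Type*}

/-- The rewards of the transitions are bounded. -/
def BoundedRewards (M : MDP S) : Prop :=
  ∃ m : ℝ, ∀ s s', M.step s s' → |M.reward s s'| ≤ m

/-- A (history dependent, randomized) strategy.  The value `act w s` is the distribution chosen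
after the partial run that visits the states of `w`, in this order, and then the controlled
state `s`.  (The values at lists that are no partial runs are irrelevant.) -/
structure Strategy (M : MDP S) where
  act : List S → {s : S // s ∈ M.controlled} → PMF S
  step_of_act : ∀ w s s', act w s s' ≠ 0 → M.step s s'

/-- The strategy extended to the partial runs that end in a random state. -/
def Strategy.next {M : MDP S} (σ : M.Strategy) (w : List S) (s : S) : PMF S :=
  open Classical in
  if h : s ∈ M.controlled then σ.act w ⟨s, h⟩ else M.prob ⟨s, h⟩

/-- The first `n` states of the sequence `ω`, that is, those strictly before position `n`. -/
def past (ω : ℕ → S) (n : ℕ) : List S := List.ofFn fun i : Fin n => ω i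

section Measure

variable [Countable S] [MeasurableSpace S] [DiscreteMeasurableSpace S]

/-- The law of the state at time `n + 1`, given the states at the times `0, …, n`. -/
def Strategy.stepKernel {M : MDP S} (σ : M.Strategy) (n : ℕ) :
    Kernel (Finset.Iic n → S) S where
  toFun h := (σ.next
    (List.ofFn fun i : Fin n => h ⟨i, Finset.mem_Iic.2 i.2.le⟩)
    (h ⟨n, Finset.mem_Iic.2 le_rfl⟩)).toMeasure
  measurable' := measurable_of_countable _

instance {M : MDP S} (σ : M.Strategy) (n : ℕ) : IsMarkovKernel (σ.stepKernel n) :=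
  ⟨fun _ => PMF.toMeasure.isProbabilityMeasure _⟩

/-- The law of the run (as the sequence of its states) from `s` under the strategy `σ`: the
probability measure of the Ionescu-Tulcea theorem for the step kernels of `σ`. -/
def Strategy.runMeasure {M : MDP S} (σ : M.Strategy) (s : S) : Measure (ℕ → S) :=
  Kernel.traj (X := fun _ => S) σ.stepKernel 0 fun _ => s

end Measure

/-- The two payoffs of a run: the limsup and the liminf of its transition rewards. -/
inductive PayoffKind
  | limsup
  | liminf

/-- The limsup (resp. liminf) of the transition rewards along the run `ω`. -/
def payoff (M : MDP S) : PayoffKind → (ℕ → S) → EReal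
  | .limsup, ω => Filter.limsup (fun n => (M.reward (ω n) (ω (n + 1)) : EReal)) atTop
  | .liminf, ω => Filter.liminf (fun n => (M.reward (ω n) (ω (n + 1)) : EReal)) atTop

section Objectives

variable [Countable S] [MeasurableSpace S] [DiscreteMeasurableSpace S]

/-- The probability that the limsup (resp. liminf) of the rewards is nonnegative. -/
def thresholdProb (M : MDP S) (k : PayoffKind) (s : S) (σ : M.Strategy) : ℝ≥0∞ :=
  σ.runMeasure s {ω | 0 ≤ M.payoff k ω}

/-- The value of the state `s` for the threshold objective. -/
def thresholdValue (M : MDP S) (k : PayoffKind) (s : S) : ℝ≥0∞ :=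
  ⨆ σ : M.Strategy, M.thresholdProb k s σ

/-- `σ` is optimal from `s` for the threshold objective. -/
def IsThresholdOptimal (M : MDP S) (k : PayoffKind) (s : S) (σ : M.Strategy) : Prop :=
  M.thresholdValue k s ≤ M.thresholdProb k s σ

/-- The expected limsup (resp. liminf) of the rewards, for bounded rewards.  (Then the payoff
is almost surely finite and bounded, so that the integral below is a genuine one.) -/
def expectedPayoff (M : MDP S) (k : PayoffKind) (s : S) (σ : M.Strategy) : ℝ :=
  ∫ ω, (M.payoff k ω).toReal ∂σ.runMeasure s

/-- The value of the state `s` for the expected payoff. -/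
def expectedValue (M : MDP S) (k : PayoffKind) (s : S) : EReal :=
  ⨆ σ : M.Strategy, (M.expectedPayoff k s σ : EReal)

/-- `σ` is optimal from `s` for the expected payoff. -/
def IsExpectedOptimal (M : MDP S) (k : PayoffKind) (s : S) (σ : M.Strategy) : Prop :=
  M.expectedValue k s ≤ (M.expectedPayoff k s σ : EReal)

end Objectives

/-- `T` is the transition relation of a sub-MDP of `M`: it consists of transitions of `M`, every
state keeps a successor, and no transition of positive probability of a random state is lost. -/
structure IsSubStep (M : MDP S) (T : S → S → Prop) : Prop where
  step_of : ∀ s s', T s s' → M.step s s'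
  exists_step : ∀ s, ∃ s', T s s'
  of_prob : ∀ s s', M.prob s s' ≠ 0 → T s s'

/-- The sub-MDP of `M` with the transition relation `T`, equipped with the reward function `u`. -/
def restrict (M : MDP S) (T : S → S → Prop) (hT : M.IsSubStep T) (u : S → S → ℝ) : MDP S where
  controlled := M.controlled
  step := T
  exists_step := hT.exists_step
  prob := M.prob
  step_of_prob := hT.of_prob
  reward := u

/-- A strategy of a sub-MDP of `M`, regarded as a strategy of `M`. -/
def Strategy.lift {M : MDP S} {T : S → S → Prop} {hT : M.IsSubStep T} {u : S → S → ℝ}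
    (σ : (M.restrict T hT u).Strategy) : M.Strategy where
  act := σ.act
  step_of_act w s s' h := hT.step_of _ _ (σ.step_of_act w s s' h)

/-- All choices of the strategy are Dirac distributions. -/
def Strategy.IsDeterministic {M : MDP S} (σ : M.Strategy) : Prop :=
  ∀ w s, ∃ s', σ.act w s = PMF.pure s'

/-- A type of memory: a countable set of memory modes, the modes in which a strategy may start,
and the changes of the mode that are allowed in one step.  For instance, a step counter with
the additional memory `F` has the modes `ℕ × F`, starts in some `(0, f)` and moves from
`(n, f)` to some `(n + 1, f')`. -/
structure MemoryType where
  Mode : Type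
  countable_mode : Countable Mode
  start : Set Mode
  move : Mode → Mode → Prop

/-- A transition function `τ : Mode × S → 𝒟(Mode × S)` with an initial mode, by which a
strategy of `M` can be implemented with the memory `X`. -/
structure Implementation (M : MDP S) (X : MemoryType) where
  init : X.Mode
  init_mem : init ∈ X.start
  trans : X.Mode → S → PMF (X.Mode × S)
  move_of_trans : ∀ m s m' s', trans m s (m', s') ≠ 0 → X.move m m'
  step_of_trans : ∀ m s m' s', s ∈ M.controlled → trans m s (m', s') ≠ 0 → M.step s s'
  tsum_trans : ∀ m (s : {s : S // s ∉ M.controlled}) s',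
    ∑' m', trans m s (m', s') = M.prob s s'

/-- The probability that the Markov chain on `Mode × S` given by `τ`, started in the initial
mode and the state `ω 0`, passes through the states `ω 0, …, ω n` and is then in mode `m`. -/
def Implementation.weight {M : MDP S} {X : MemoryType} (τ : M.Implementation X) (ω : ℕ → S) :
    ℕ → X.Mode → ℝ≥0∞
  | 0, m => open Classical in if m = τ.init then 1 else 0
  | n + 1, m' => ∑' m, τ.weight ω n m * τ.trans m (ω n) (m', ω (n + 1))

/-- The strategy induced from `s₀` by `τ` is `σ`.  After a partial run, it moves to `s'` with the
probability of doing so in the Markov chain on `Mode × S`, conditioned on the states of the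
partial run.  (The equation is multiplied by the probability of the partial run, so that it is
void for the partial runs of probability zero, where nothing is induced.) -/
def Implementation.Induces {M : MDP S} {X : MemoryType} (τ : M.Implementation X) (s₀ : S)
    (σ : M.Strategy) : Prop :=
  ∀ ω : ℕ → S, ω 0 = s₀ → ∀ (n : ℕ) (h : ω n ∈ M.controlled) (s' : S),
    (∑' m, τ.weight ω n m) * σ.act (past ω n) ⟨ω n, h⟩ s' =
      ∑' m, ∑' m', τ.weight ω n m * τ.trans m (ω n) (m', s')

/-- The name of a strategy class `Det(𝒳)` or `Rand(𝒳)`, where `𝒳` is a family of memory types. -/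
structure StrategyClass where
  deterministic : Prop
  memory : Set MemoryType

/-- As a strategy from `s₀`, `σ` belongs to the class `C`. -/
def StrategyClass.Contains (C : StrategyClass) {M : MDP S} (s₀ : S) (σ : M.Strategy) : Prop :=
  (C.deterministic → σ.IsDeterministic) ∧
    ∃ X ∈ C.memory, ∃ τ : M.Implementation X, τ.Induces s₀ σ

end MDP

end

/-! Let v be the value function of the expected payoff. From each state that has an optimal
strategy, keep only the transitions to states that also have one, with equal v if the source is
controlled. The new reward is u(s,s') = r(s,s') - v(s). On a run along which v tends to a real l,
the payoff for r is the payoff for u plus l (`payoff_sub_add`).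

Under an optimal strategy, v(s_n) is the conditional expectation of the payoff given s_0, …, s_n
(`IsExpectedOptimal.setIntegral_value`). By Lévy's upward theorem v(s_n) tends almost surely to the
payoff, so the u-payoff is almost surely 0. Such a strategy takes only kept transitions, hence the
threshold value is 1 and is attained.

Conversely, a threshold-optimal strategy then wins almost surely. Along kept transitions v(s_n) is a
bounded martingale, so it converges to some l of mean v(s_0)
(`Strategy.Uses.exists_ae_tendsto_value`). A nonnegative u-payoff says that the r-payoff is at least
l, so its expectation is at least v(s_0). Strategies and their implementations in the sub-MDP carry
over unchanged, which gives the statements on strategy classes. -/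

namespace MDP

variable {S : Type*}

/-! ### Cylinders, shifts and splicing of sequences -/

/-- The sequences that agree with `f` up to time `n`. -/
def cyl (f : ℕ → S) (n : ℕ) : Set (ℕ → S) := {ω | ∀ i ≤ n, ω i = f i}

/-- The run seen from time `n` on. -/
def shift (n : ℕ) (ω : ℕ → S) : ℕ → S := fun i => ω (n + i)

/-- The sequence that follows `f` before time `n` and `g` from time `n` on. -/
def splice (n : ℕ) (f g : ℕ → S) : ℕ → S := fun i => if i < n then f i else g (i - n)

lemma cyl_antitone (f : ℕ → S) : Antitone (cyl f) :=
  fun _ _ h _ hω i hi => hω i (hi.trans h)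

lemma cyl_congr {f g : ℕ → S} {n : ℕ} (h : f ∈ cyl g n) : cyl f n = cyl g n := by
  ext ω
  exact forall₂_congr fun i hi => by rw [h i hi]

lemma cyl_succ_eq (f : ℕ → S) (n : ℕ) :
    cyl f (n + 1) = cyl f n ∩ {ω | ω (n + 1) = f (n + 1)} := by
  ext ω
  simp only [cyl, Set.mem_ofPred_eq, Set.mem_inter_iff]
  exact ⟨fun h => ⟨fun i hi => h i (by omega), h _ le_rfl⟩, fun h i hi =>
    (Nat.le_succ_iff.1 hi).elim (h.1 i) fun e => e ▸ h.2⟩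

lemma cyl_eq_preimage (f : ℕ → S) (n : ℕ) :
    cyl f n = Preorder.frestrictLe (π := fun _ => S) n ⁻¹'
      {Preorder.frestrictLe (π := fun _ => S) n f} := by
  ext ω
  simp [cyl, funext_iff, Preorder.frestrictLe]

@[simp] lemma length_past (f : ℕ → S) (n : ℕ) : (past f n).length = n := by simp [past]

lemma past_congr {f g : ℕ → S} {n : ℕ} (h : ∀ i < n, f i = g i) : past f n = past g n := by
  unfold past
  congr 1
  funext i
  exact h i i.2

lemma past_add (f : ℕ → S) (n m : ℕ) : past f (n + m) = past f n ++ past (shift n f) m := by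
  unfold past
  rw [List.ofFn_add]
  rfl

lemma past_succ (f : ℕ → S) (n : ℕ) : past f (n + 1) = past f n ++ [f n] := by
  rw [past_add]
  simp [past, shift]

@[simp] lemma shift_splice (n : ℕ) (f g : ℕ → S) : shift n (splice n f g) = g := by
  funext i
  simp [shift, splice]

lemma past_splice (n m : ℕ) (f g : ℕ → S) :
    past (splice n f g) (n + m) = past f n ++ past g m := by
  rw [past_add, shift_splice, past_congr (g := f)]
  intro i hi
  simp [splice, hi]

lemma splice_add (n m : ℕ) (f g : ℕ → S) : splice n f g (n + m) = g m := by simp [splice]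

/-- A cylinder over a cylinder is the cylinder of the spliced sequence. -/
lemma shift_preimage_cyl_inter (n m : ℕ) (f g : ℕ → S) (h : g 0 = f n) :
    shift n ⁻¹' cyl g m ∩ cyl f n = cyl (splice n f g) (n + m) := by
  ext ω
  simp only [Set.mem_inter_iff, Set.mem_preimage, cyl, Set.mem_ofPred_eq, shift]
  constructor
  · rintro ⟨h1, h2⟩ i hi
    by_cases hin : i < n
    · simp [splice, hin, h2 i hin.le]
    · obtain ⟨j, rfl⟩ := Nat.exists_eq_add_of_le (not_lt.1 hin)
      rw [splice_add, h1 j (by omega)]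
  · intro h1
    refine ⟨fun i hi => by rw [h1 _ (by omega), splice_add], fun i hi => ?_⟩
    rw [h1 i (by omega)]
    rcases hi.lt_or_eq with hi | rfl
    · simp [splice, hi]
    · simpa [h] using splice_add i 0 f g

/-! ### Measures and conditional expectations via cylinders -/

section Measure

variable [MeasurableSpace S]

lemma measurable_shift (n : ℕ) : Measurable (shift (S := S) n) :=
  measurable_pi_lambda _ fun _ => measurable_pi_apply _

variable [Countable S] [DiscreteMeasurableSpace S]

lemma measurableSet_cyl (f : ℕ → S) (n : ℕ) : MeasurableSet (cyl f n) := by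
  rw [cyl_eq_preimage]
  exact Preorder.measurable_frestrictLe n (measurableSet_singleton _)

/-- Laws of sequences that agree on the cylinders of length `n + 1` have the same marginals. -/
lemma map_frestrictLe_eq {μ ν : Measure (ℕ → S)} {n : ℕ} (h : ∀ f, μ (cyl f n) = ν (cyl f n)) :
    μ.map (Preorder.frestrictLe (π := fun _ => S) n) =
      ν.map (Preorder.frestrictLe (π := fun _ => S) n) := by
  refine Measure.ext_of_singleton fun a => ?_
  rw [Measure.map_apply (by fun_prop) (measurableSet_singleton _),
    Measure.map_apply (by fun_prop) (measurableSet_singleton _)]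
  -- A finite tuple extends to a sequence only if there is some state to pad with; without states
  -- there is no tuple, as time 0 is always present.
  rcases isEmpty_or_nonempty S with hS | ⟨⟨s⟩⟩
  · exact isEmptyElim (a ⟨0, by simp⟩)
  · have : a = Preorder.frestrictLe (π := fun _ => S) n
        (fun i => if h : i ∈ Finset.Iic n then a ⟨i, h⟩ else s) := by
      funext i
      have := i.2
      simp [-Finset.mem_Iic, this]
    rw [this, ← cyl_eq_preimage, h]

/-- A finite measure on sequences is determined by its values on cylinders. -/
lemma measure_ext_of_cyl {μ ν : Measure (ℕ → S)} [IsFiniteMeasure μ]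
    (h : ∀ f n, μ (cyl f n) = ν (cyl f n)) : μ = ν := by
  -- Every finite set of times lies in an initial segment, so all finite marginals factor through
  -- those of initial segments.
  refine IsProjectiveLimit.unique (P := fun I => μ.map I.restrict) (fun _ => rfl) fun I => ?_
  have hI : I ⊆ Finset.Iic (I.sup id) := fun i hi =>
    Finset.mem_Iic.2 (Finset.le_sup (f := id) hi)
  have e : (I.restrict : (ℕ → S) → _) =
      Finset.restrict₂ (π := fun _ => S) hI ∘ Preorder.frestrictLe (I.sup id) := rfl
  change ν.map I.restrict = μ.map I.restrict
  rw [e, ← Measure.map_map (by fun_prop) (by fun_prop),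
    ← Measure.map_map (by fun_prop) (by fun_prop), map_frestrictLe_eq fun f => h f _]

omit [DiscreteMeasurableSpace S] in
/-- Almost every sequence has only cylinders of positive measure. -/
lemma ae_cyl_ne_zero (μ : Measure (ℕ → S)) : ∀ᵐ ω ∂μ, ∀ n, μ (cyl ω n) ≠ 0 := by
  refine ae_all_iff.2 fun n => ?_
  -- There are only countably many cylinders of a given length, so the null ones have a null union.
  have : {ω | ¬ μ (cyl ω n) ≠ 0} ⊆
      ⋃ a ∈ {a | μ (Preorder.frestrictLe (π := fun _ => S) n ⁻¹' {a}) = 0},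
        Preorder.frestrictLe (π := fun _ => S) n ⁻¹' {a} := by
    intro ω hω
    simp only [ne_eq, not_not, Set.mem_ofPred_eq, cyl_eq_preimage] at hω
    simp [hω]
  refine measure_mono_null this ?_
  rw [measure_biUnion_null_iff (Set.to_countable _)]
  exact fun a ha => ha

/-- An inequality of integrals over the cylinders of length `n + 1` extends to all events that
depend on the first `n + 1` states. -/
lemma setIntegral_mono_of_cyl {μ : Measure (ℕ → S)} {n : ℕ} {F G : (ℕ → S) → ℝ}
    (hF : Integrable F μ) (hG : Integrable G μ)
    (h : ∀ f, ∫ ω in cyl f n, F ω ∂μ ≤ ∫ ω in cyl f n, G ω ∂μ)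
    (B : Set (Finset.Iic n → S)) :
    ∫ ω in Preorder.frestrictLe (π := fun _ => S) n ⁻¹' B, F ω ∂μ ≤
      ∫ ω in Preorder.frestrictLe (π := fun _ => S) n ⁻¹' B, G ω ∂μ := by
  have hB : Preorder.frestrictLe (π := fun _ => S) n ⁻¹' B =
      ⋃ b : B, Preorder.frestrictLe (π := fun _ => S) n ⁻¹' {b.1} := by
    ext; simp
  have hm : ∀ b : B, MeasurableSet (Preorder.frestrictLe (π := fun _ => S) n ⁻¹' {b.1}) :=
    fun b => Preorder.measurable_frestrictLe n (measurableSet_singleton _)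
  have hd : Pairwise (Function.onFun Disjoint
      fun b : B => Preorder.frestrictLe (π := fun _ => S) n ⁻¹' {b.1}) := by
    intro b c hbc
    exact Disjoint.preimage _ (by simpa [Subtype.ext_iff] using hbc)
  rw [hB]
  refine hasSum_le (fun b => ?_) (hasSum_integral_iUnion hm hd hF.integrableOn)
    (hasSum_integral_iUnion hm hd hG.integrableOn)
  rcases (Preorder.frestrictLe (π := fun _ => S) n ⁻¹' {b.1}).eq_empty_or_nonempty with he | ⟨f, hf⟩
  · simp [he]
  · have : Preorder.frestrictLe (π := fun _ => S) n f = b.1 := hf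
    rw [← this, ← cyl_eq_preimage]
    exact h f

lemma setIntegral_congr_of_cyl {μ : Measure (ℕ → S)} {n : ℕ} {F G : (ℕ → S) → ℝ}
    (hF : Integrable F μ) (hG : Integrable G μ)
    (h : ∀ f, ∫ ω in cyl f n, F ω ∂μ = ∫ ω in cyl f n, G ω ∂μ)
    (B : Set (Finset.Iic n → S)) :
    ∫ ω in Preorder.frestrictLe (π := fun _ => S) n ⁻¹' B, F ω ∂μ =
      ∫ ω in Preorder.frestrictLe (π := fun _ => S) n ⁻¹' B, G ω ∂μ :=
  (setIntegral_mono_of_cyl hF hG (fun f => (h f).le) B).antisymm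
    (setIntegral_mono_of_cyl hG hF (fun f => (h f).ge) B)

/-- The conditional expectation given the first `n + 1` states is determined by the integrals over
the cylinders of length `n + 1`. -/
lemma condExp_piLE_ae_eq {μ : Measure (ℕ → S)} [IsFiniteMeasure μ] {n : ℕ}
    {F : (ℕ → S) → ℝ} {g : S → ℝ} (hF : Integrable F μ)
    (hg : Integrable (fun ω => g (ω n)) μ)
    (h : ∀ f, ∫ ω in cyl f n, g (ω n) ∂μ = ∫ ω in cyl f n, F ω ∂μ) :
    (fun ω => g (ω n)) =ᵐ[μ] μ[F | Filtration.piLE (X := fun _ => S) n] := by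
  refine ae_eq_condExp_of_forall_setIntegral_eq (Filtration.piLE.le n) hF
    (fun _ _ _ => hg.integrableOn) (fun s hs _ => ?_) ?_
  · rw [Filtration.piLE_eq_comap_frestrictLe] at hs
    obtain ⟨B, -, rfl⟩ := hs
    exact setIntegral_congr_of_cyl hg hF h B
  · refine StronglyMeasurable.aestronglyMeasurable ?_
    rw [Filtration.piLE_eq_comap_frestrictLe]
    have : (fun ω : ℕ → S => g (ω n)) =
      (fun a : Finset.Iic n → S => g (a ⟨n, by simp⟩)) ∘ Preorder.frestrictLe (π := fun _ => S) n :=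
      rfl
    rw [this]
    exact ((measurable_of_countable _).comp (comap_measurable _)).stronglyMeasurable

end Measure

/-! ### Residual strategies and switching -/

/-- The strategy that `σ` follows after the partial run `w`. -/
def Strategy.after {M : MDP S} (σ : M.Strategy) (w : List S) : M.Strategy where
  act w' t := σ.act (w ++ w') t
  step_of_act _ s s' h := σ.step_of_act _ s s' h

lemma Strategy.next_after {M : MDP S} (σ : M.Strategy) (w w' : List S) (s : S) :
    (σ.after w).next w' s = σ.next (w ++ w') s := rfl

lemma Strategy.step_of_next {M : MDP S} (σ : M.Strategy) {w : List S} {s s' : S}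
    (h : σ.next w s s' ≠ 0) : M.step s s' := by
  unfold Strategy.next at h
  split_ifs at h with hs
  · exact σ.step_of_act _ _ _ h
  · exact M.step_of_prob _ _ h

/-- The strategy that follows `σ` before time `n`, and from then on the strategy `ρ s`, where `s`
is the state at time `n`. -/
def Strategy.switch {M : MDP S} (σ : M.Strategy) (n : ℕ) (ρ : S → M.Strategy) : M.Strategy where
  act w t := if w.length < n then σ.act w t else
    -- The current state is appended because it is itself the state at time `n` when `w` has length
    -- `n`. The default of `getD` is never used here.
    (ρ ((w ++ [t.1]).getD n t.1)).act (w.drop n) t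
  step_of_act w s s' h := by
    split_ifs at h
    · exact σ.step_of_act _ _ _ h
    · exact (ρ _).step_of_act _ _ _ h

lemma Strategy.next_switch_of_lt {M : MDP S} (σ : M.Strategy) {n : ℕ} (ρ : S → M.Strategy)
    {w : List S} (hw : w.length < n) (s : S) : (σ.switch n ρ).next w s = σ.next w s := by
  simp [Strategy.next, Strategy.switch, hw]

lemma Strategy.next_switch_append {M : MDP S} (σ : M.Strategy) (n : ℕ) (ρ : S → M.Strategy)
    (f g : ℕ → S) (h : g 0 = f n) (m : ℕ) :
    (σ.switch n ρ).next (past f n ++ past g m) (g m) = (ρ (f n)).next (past g m) (g m) := by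
  have e : (past f n ++ past g m ++ [g m]).getD n (g m) = f n := by
    rw [List.append_assoc, ← past_succ, List.getD_append_right _ _ _ _ (by simp), ← h]
    simp [past]
  have d : (past f n ++ past g m).drop n = past g m := by
    simp
  have l : ¬ (past f n ++ past g m).length < n := by simp
  unfold Strategy.next
  split_ifs with hs
  · simp only [Strategy.switch, if_neg l, e, d]
  · rfl

/-! ### The law of the run and the Markov property -/

section Measure

variable [Countable S] [MeasurableSpace S] [DiscreteMeasurableSpace S]

instance {M : MDP S} (σ : M.Strategy) (s : S) : IsProbabilityMeasure (σ.runMeasure s) := by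
  unfold Strategy.runMeasure
  infer_instance

open Classical in
lemma runMeasure_cyl_zero {M : MDP S} (σ : M.Strategy) (s : S) (f : ℕ → S) :
    σ.runMeasure s (cyl f 0) = if f 0 = s then 1 else 0 := by
  rw [cyl_eq_preimage, ← Measure.map_apply (by fun_prop) (measurableSet_singleton _),
    Strategy.runMeasure, Kernel.traj_map_frestrictLe_apply, Kernel.partialTraj_self,
    Kernel.id_apply, Measure.dirac_apply' _ (measurableSet_singleton _)]
  by_cases h : f 0 = s
  · rw [if_pos h, Set.indicator_of_mem]
    · rfl
    · rw [Set.mem_singleton_iff]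
      funext ⟨i, hi⟩
      obtain rfl : i = 0 := by simpa using hi
      exact h.symm
  · rw [if_neg h, Set.indicator_of_notMem]
    intro h'
    exact h (congrFun h' ⟨0, by simp⟩).symm

/-- Together with `runMeasure_cyl_zero` this recursion determines the law of the run; the
Ionescu-Tulcea construction is not unfolded again. -/
lemma runMeasure_cyl_succ {M : MDP S} (σ : M.Strategy) (s : S) (f : ℕ → S) (n : ℕ) :
    σ.runMeasure s (cyl f (n + 1)) =
      σ.runMeasure s (cyl f n) * σ.next (past f n) (f n) (f (n + 1)) := by
  have e : cyl f (n + 1) =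
      (fun ω : ℕ → S => (Preorder.frestrictLe (π := fun _ => S) n ω, ω (n + 1))) ⁻¹'
        ({Preorder.frestrictLe (π := fun _ => S) n f} ×ˢ {f (n + 1)}) := by
    rw [cyl_succ_eq, cyl_eq_preimage]
    ext; simp
  rw [e, ← Measure.map_apply (by fun_prop)
      ((measurableSet_singleton _).prod (measurableSet_singleton _)), Strategy.runMeasure,
    ← Kernel.partialTraj_compProd_eq_map_traj (X := fun _ => S) (Nat.zero_le n),
    Measure.compProd_apply_prod (measurableSet_singleton _) (measurableSet_singleton _),
    lintegral_singleton, ← Kernel.traj_map_frestrictLe_apply,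
    Measure.map_apply (by fun_prop) (measurableSet_singleton _), ← cyl_eq_preimage, mul_comm]
  congr 1
  exact PMF.toMeasure_apply_singleton _ _ (measurableSet_singleton _)

lemma eq_of_runMeasure_cyl_ne_zero {M : MDP S} {σ : M.Strategy} {s : S} {f : ℕ → S} {n : ℕ}
    (h : σ.runMeasure s (cyl f n) ≠ 0) : f 0 = s := by
  by_contra hf
  refine h (measure_mono_null (cyl_antitone f (Nat.zero_le n)) ?_)
  rw [runMeasure_cyl_zero, if_neg hf]

lemma runMeasure_cyl_congr {M M' : MDP S} {σ : M.Strategy} {σ' : M'.Strategy} {s : S} {n : ℕ}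
    (h : ∀ f, ∀ m < n, σ.runMeasure s (cyl f m) ≠ 0 →
      σ.next (past f m) (f m) = σ'.next (past f m) (f m)) (f : ℕ → S) :
    σ.runMeasure s (cyl f n) = σ'.runMeasure s (cyl f n) := by
  induction n with
  | zero => rw [runMeasure_cyl_zero, runMeasure_cyl_zero]
  | succ n ih =>
    rw [runMeasure_cyl_succ, runMeasure_cyl_succ, ← ih fun f m hm => h f m (by omega)]
    by_cases h0 : σ.runMeasure s (cyl f n) = 0
    · simp [h0]
    · rw [h f n (by omega) h0]

/-- The law of the run depends only on the choices after partial runs of positive probability. -/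
lemma runMeasure_congr {M M' : MDP S} {σ : M.Strategy} {σ' : M'.Strategy} {s : S}
    (h : ∀ f m, σ.runMeasure s (cyl f m) ≠ 0 →
      σ.next (past f m) (f m) = σ'.next (past f m) (f m)) :
    σ.runMeasure s = σ'.runMeasure s :=
  measure_ext_of_cyl fun f _ => runMeasure_cyl_congr (fun f m _ => h f m) f

/-- The Markov property: after a partial run, the run continues as under the strategy that is
left over. -/
lemma map_shift_restrict_cyl {M : MDP S} (σ : M.Strategy) (s : S) (f : ℕ → S) (n : ℕ) :
    ((σ.runMeasure s).restrict (cyl f n)).map (shift n) =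
      σ.runMeasure s (cyl f n) • (σ.after (past f n)).runMeasure (f n) := by
  refine measure_ext_of_cyl fun g m => ?_
  rw [Measure.map_apply (measurable_shift n) (measurableSet_cyl g m),
    Measure.restrict_apply (measurable_shift n (measurableSet_cyl g m)),
    Measure.smul_apply, smul_eq_mul]
  -- If `g` starts at `f n`, both sides obey the same recursion in `m`; otherwise both vanish.
  by_cases hg : g 0 = f n
  · rw [shift_preimage_cyl_inter n m f g hg]
    induction m with
    | zero =>
      rw [runMeasure_cyl_zero, if_pos hg, mul_one]
      congr 1
      refine cyl_congr fun i hi => ?_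
      rcases hi.lt_or_eq with h | rfl
      · exact if_pos h
      · rw [← hg]; exact splice_add i 0 f g
    | succ m ih =>
      rw [runMeasure_cyl_succ, ← mul_assoc, ← ih, ← add_assoc, runMeasure_cyl_succ, past_splice,
        splice_add, Strategy.next_after]
      congr 2
      exact splice_add n (m + 1) f g
  · have h1 : (σ.after (past f n)).runMeasure (f n) (cyl g m) = 0 := by
      by_contra h
      exact hg (eq_of_runMeasure_cyl_ne_zero h)
    have h2 : shift n ⁻¹' cyl g m ∩ cyl f n = ∅ := by
      ext ω
      simp only [Set.mem_inter_iff, Set.mem_preimage, cyl, Set.mem_ofPred_eq, shift,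
        Set.mem_empty_iff_false, iff_false, not_and]
      intro h1 h2
      exact hg ((h1 0 (Nat.zero_le m)).symm.trans (h2 n le_rfl))
    rw [h1, h2, measure_empty, mul_zero]

lemma setIntegral_cyl_shift {M : MDP S} (σ : M.Strategy) (s : S) (f : ℕ → S) (n : ℕ)
    {F : (ℕ → S) → ℝ} (hF : Measurable F) :
    ∫ ω in cyl f n, F (shift n ω) ∂σ.runMeasure s =
      (σ.runMeasure s).real (cyl f n) * ∫ ω, F ω ∂(σ.after (past f n)).runMeasure (f n) := by
  rw [← integral_map (measurable_shift n).aemeasurable hF.aestronglyMeasurable,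
    map_shift_restrict_cyl, integral_smul_measure]
  rfl

lemma after_switch_runMeasure {M : MDP S} (σ : M.Strategy) (n : ℕ) (ρ : S → M.Strategy)
    (f : ℕ → S) :
    ((σ.switch n ρ).after (past f n)).runMeasure (f n) = (ρ (f n)).runMeasure (f n) :=
  runMeasure_congr fun g m hg => σ.next_switch_append n ρ f g (eq_of_runMeasure_cyl_ne_zero hg) m

lemma switch_runMeasure_cyl {M : MDP S} (σ : M.Strategy) (s : S) (n : ℕ) (ρ : S → M.Strategy)
    (f : ℕ → S) :
    (σ.switch n ρ).runMeasure s (cyl f n) = σ.runMeasure s (cyl f n) :=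
  runMeasure_cyl_congr (fun g m hm _ => σ.next_switch_of_lt ρ (by simpa using hm) _) f

lemma integral_state_congr {μ ν : Measure (ℕ → S)} {n : ℕ}
    (h : ∀ f, μ (cyl f n) = ν (cyl f n)) (g : S → ℝ) :
    ∫ ω, g (ω n) ∂μ = ∫ ω, g (ω n) ∂ν := by
  have e : ∀ κ : Measure (ℕ → S), ∫ ω, g (ω n) ∂κ =
      ∫ a, g (a ⟨n, by simp⟩) ∂κ.map (Preorder.frestrictLe (π := fun _ => S) n) := fun κ => by
    rw [integral_map (by fun_prop)]
    · rfl
    · exact (measurable_of_countable _).aestronglyMeasurable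
  rw [e, e, map_frestrictLe_eq h]

/-- Almost surely, the run uses only transitions that the strategy chooses with positive
probability, after partial runs of positive probability. -/
lemma ae_next_ne_zero {M : MDP S} (σ : M.Strategy) (s : S) :
    ∀ᵐ ω ∂σ.runMeasure s, ω 0 = s ∧ ∀ n, σ.runMeasure s (cyl ω n) ≠ 0 ∧
      σ.next (past ω n) (ω n) (ω (n + 1)) ≠ 0 := by
  filter_upwards [ae_cyl_ne_zero (σ.runMeasure s)] with ω h
  refine ⟨eq_of_runMeasure_cyl_ne_zero (h 0), fun n => ⟨h n, fun h0 => h (n + 1) ?_⟩⟩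
  rw [runMeasure_cyl_succ, h0, mul_zero]

end Measure

/-! ### The payoff of a single run -/

/-- Prefix independence lets the payoff after a partial run be computed as that of the residual
strategy. -/
lemma payoff_shift (M : MDP S) (k : PayoffKind) (n : ℕ) (ω : ℕ → S) :
    M.payoff k (shift n ω) = M.payoff k ω := by
  cases k
  · have := limsup_nat_add (fun i => (M.reward (ω i) (ω (i + 1)) : EReal)) n
    simp only [payoff, shift]
    rw [← this]
    simp only [add_comm n, add_right_comm]
  · have := liminf_nat_add (fun i => (M.reward (ω i) (ω (i + 1)) : EReal)) n
    simp only [payoff, shift]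
    rw [← this]
    simp only [add_comm n, add_right_comm]

lemma payoff_mem_Icc (M : MDP S) (k : PayoffKind) {ω : ℕ → S} {m : ℝ}
    (h : ∀ n, |M.reward (ω n) (ω (n + 1))| ≤ m) :
    M.payoff k ω ∈ Set.Icc ((-m : ℝ) : EReal) (m : EReal) := by
  have h1 : ∀ n, ((-m : ℝ) : EReal) ≤ (M.reward (ω n) (ω (n + 1)) : EReal) := fun n =>
    EReal.coe_le_coe_iff.2 (abs_le.1 (h n)).1
  have h2 : ∀ n, (M.reward (ω n) (ω (n + 1)) : EReal) ≤ (m : EReal) := fun n =>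
    EReal.coe_le_coe_iff.2 (abs_le.1 (h n)).2
  have h3 := liminf_le_limsup (f := atTop)
    (u := fun n => (M.reward (ω n) (ω (n + 1)) : EReal))
  have h4 := le_liminf_of_le (f := atTop) (hf := by isBoundedDefault) (Eventually.of_forall h1)
  have h5 := limsup_le_of_le (f := atTop) (hf := by isBoundedDefault) (Eventually.of_forall h2)
  cases k
  · exact ⟨h4.trans h3, h5⟩
  · exact ⟨h4, h3.trans h5⟩

lemma coe_toReal_payoff (M : MDP S) (k : PayoffKind) {ω : ℕ → S} {m : ℝ}
    (h : ∀ n, |M.reward (ω n) (ω (n + 1))| ≤ m) :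
    ((M.payoff k ω).toReal : EReal) = M.payoff k ω := by
  obtain ⟨h1, h2⟩ := M.payoff_mem_Icc k h
  exact EReal.coe_toReal (fun e => by simp [e] at h2) (fun e => by simp [e] at h1)

lemma abs_toReal_payoff_le (M : MDP S) (k : PayoffKind) {ω : ℕ → S} {m : ℝ}
    (h : ∀ n, |M.reward (ω n) (ω (n + 1))| ≤ m) : |(M.payoff k ω).toReal| ≤ m := by
  have h0 := M.payoff_mem_Icc k h
  rw [← M.coe_toReal_payoff k h] at h0
  exact abs_le.2 ⟨EReal.coe_le_coe_iff.1 h0.1, EReal.coe_le_coe_iff.1 h0.2⟩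

/-- Subtracting a convergent sequence from the rewards subtracts its limit from the payoff. -/
lemma payoff_sub_add {M N : MDP S} (k : PayoffKind) {ω : ℕ → S} {v : S → ℝ} {l : ℝ}
    (hu : ∀ s s', N.reward s s' = M.reward s s' - v s)
    (hv : Tendsto (fun n => v (ω n)) atTop (nhds l)) :
    N.payoff k ω + l = M.payoff k ω := by
  have hv' : Tendsto (fun n => (v (ω n) : EReal)) atTop (nhds (l : EReal)) :=
    (continuous_coe_real_ereal.tendsto l).comp hv
  have hs := hv'.limsup_eq
  have hi := hv'.liminf_eq
  -- The limsup of a sum lies between limsup plus liminf and limsup plus limsup (dually for the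
  -- liminf); for a convergent summand the bounds coincide.
  have e : (fun n => (N.reward (ω n) (ω (n + 1)) : EReal)) + (fun n => (v (ω n) : EReal)) =
      fun n => (M.reward (ω n) (ω (n + 1)) : EReal) := by
    funext n
    simp only [Pi.add_apply]
    rw [← EReal.coe_add, hu, sub_add_cancel]
  cases k
  · have h1 := EReal.limsup_add_le (f := atTop)
      (u := fun n => (N.reward (ω n) (ω (n + 1)) : EReal)) (v := fun n => (v (ω n) : EReal))
      (by rw [hs]; simp) (by rw [hs]; simp)
    have h2 := EReal.le_limsup_add (f := atTop)
      (u := fun n => (N.reward (ω n) (ω (n + 1)) : EReal)) (v := fun n => (v (ω n) : EReal))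
    rw [e, hs] at h1
    rw [e, hi] at h2
    exact h2.antisymm h1
  · have h1 := EReal.liminf_add_le (f := atTop) (u := fun n => (v (ω n) : EReal))
      (v := fun n => (N.reward (ω n) (ω (n + 1)) : EReal))
      (by rw [hs]; simp) (by rw [hs]; simp)
    have h2 := EReal.le_liminf_add (f := atTop)
      (u := fun n => (N.reward (ω n) (ω (n + 1)) : EReal)) (v := fun n => (v (ω n) : EReal))
    rw [add_comm, e, hs, add_comm] at h1
    rw [e, hi] at h2
    exact h2.antisymm h1

instance (M : MDP S) : Nonempty M.Strategy :=
  ⟨{ act := fun _ s => PMF.pure (M.exists_step s).choose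
     step_of_act := fun _ s s' h => by
      rw [PMF.pure_apply] at h
      split_ifs at h with e
      · exact e ▸ (M.exists_step s).choose_spec
      · exact absurd rfl h }⟩

/-! ### The value function and its behaviour under strategies -/

section Measure

variable [Countable S] [MeasurableSpace S] [DiscreteMeasurableSpace S]

lemma measurable_payoff (M : MDP S) (k : PayoffKind) : Measurable (M.payoff k) := by
  have h (n : ℕ) : Measurable fun ω : ℕ → S => (M.reward (ω n) (ω (n + 1)) : EReal) := by
    have hr : Measurable fun p : S × S => (M.reward p.1 p.2 : EReal) := measurable_of_countable _
    have hp : Measurable fun ω : ℕ → S => (ω n, ω (n + 1)) := by fun_prop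
    exact hr.comp hp
  cases k
  · exact Measurable.limsup h
  · exact Measurable.liminf h

lemma measurable_toReal_payoff (M : MDP S) (k : PayoffKind) :
    Measurable fun ω => (M.payoff k ω).toReal :=
  (M.measurable_payoff k).ereal_toReal

lemma ae_reward_le {M : MDP S} {m : ℝ} (hm : ∀ s s', M.step s s' → |M.reward s s'| ≤ m)
    (σ : M.Strategy) (s : S) :
    ∀ᵐ ω ∂σ.runMeasure s, ∀ n, |M.reward (ω n) (ω (n + 1))| ≤ m := by
  filter_upwards [ae_next_ne_zero σ s] with ω h n
  exact hm _ _ (σ.step_of_next (h.2 n).2)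

lemma integrable_payoff {M : MDP S} (hM : M.BoundedRewards) (k : PayoffKind) (σ : M.Strategy)
    (s : S) : Integrable (fun ω => (M.payoff k ω).toReal) (σ.runMeasure s) := by
  obtain ⟨m, hm⟩ := hM
  refine Integrable.of_bound (M.measurable_toReal_payoff k).aestronglyMeasurable m ?_
  filter_upwards [ae_reward_le hm σ s] with ω h
  exact M.abs_toReal_payoff_le k h

lemma abs_expectedPayoff_le {M : MDP S} {m : ℝ}
    (hm : ∀ s s', M.step s s' → |M.reward s s'| ≤ m) (k : PayoffKind) (s : S) (σ : M.Strategy) :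
    |M.expectedPayoff k s σ| ≤ m := by
  have := norm_integral_le_of_norm_le_const (μ := σ.runMeasure s)
    (f := fun ω => (M.payoff k ω).toReal) (C := m) (by
      filter_upwards [ae_reward_le hm σ s] with ω h
      exact M.abs_toReal_payoff_le k h)
  simpa [expectedPayoff] using this

/-- The value of the state `s` for the expected payoff, as a real number. -/
noncomputable def value (M : MDP S) (k : PayoffKind) (s : S) : ℝ := (M.expectedValue k s).toReal

lemma expectedValue_mem_Icc {M : MDP S} {m : ℝ}
    (hm : ∀ s s', M.step s s' → |M.reward s s'| ≤ m) (k : PayoffKind) (s : S) :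
    M.expectedValue k s ∈ Set.Icc ((-m : ℝ) : EReal) (m : EReal) := by
  have σ : M.Strategy := Classical.arbitrary _
  refine ⟨le_iSup_of_le σ ?_, iSup_le fun σ => ?_⟩
  · exact EReal.coe_le_coe_iff.2 (abs_le.1 (abs_expectedPayoff_le hm k s σ)).1
  · exact EReal.coe_le_coe_iff.2 (abs_le.1 (abs_expectedPayoff_le hm k s σ)).2

lemma coe_value {M : MDP S} (hM : M.BoundedRewards) (k : PayoffKind) (s : S) :
    (M.value k s : EReal) = M.expectedValue k s := by
  obtain ⟨m, hm⟩ := hM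
  obtain ⟨h1, h2⟩ := expectedValue_mem_Icc hm k s
  exact EReal.coe_toReal (fun e => by simp [e] at h2) (fun e => by simp [e] at h1)

lemma exists_abs_value_le {M : MDP S} (hM : M.BoundedRewards) (k : PayoffKind) :
    ∃ m, ∀ s, |M.value k s| ≤ m := by
  obtain ⟨m, hm⟩ := id hM
  refine ⟨m, fun s => ?_⟩
  have h := expectedValue_mem_Icc hm k s
  rw [← coe_value hM] at h
  exact abs_le.2 ⟨EReal.coe_le_coe_iff.1 h.1, EReal.coe_le_coe_iff.1 h.2⟩

lemma expectedPayoff_le_value {M : MDP S} (hM : M.BoundedRewards) (k : PayoffKind) (s : S)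
    (σ : M.Strategy) : M.expectedPayoff k s σ ≤ M.value k s := by
  rw [← EReal.coe_le_coe_iff, coe_value hM]
  exact le_iSup (fun σ : M.Strategy => (M.expectedPayoff k s σ : EReal)) σ

lemma isExpectedOptimal_iff {M : MDP S} (hM : M.BoundedRewards) {k : PayoffKind} {s : S}
    {σ : M.Strategy} : M.IsExpectedOptimal k s σ ↔ M.value k s ≤ M.expectedPayoff k s σ := by
  rw [← EReal.coe_le_coe_iff, coe_value hM, IsExpectedOptimal]

lemma IsExpectedOptimal.eq_value {M : MDP S} (hM : M.BoundedRewards) {k : PayoffKind} {s : S}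
    {σ : M.Strategy} (h : M.IsExpectedOptimal k s σ) : M.expectedPayoff k s σ = M.value k s :=
  (expectedPayoff_le_value hM k s σ).antisymm ((isExpectedOptimal_iff hM).1 h)

lemma exists_value_sub_le {M : MDP S} (hM : M.BoundedRewards) (k : PayoffKind) (s : S) {ε : ℝ}
    (hε : 0 < ε) : ∃ σ : M.Strategy, M.value k s - ε ≤ M.expectedPayoff k s σ := by
  have h : ((M.value k s - ε : ℝ) : EReal) < M.expectedValue k s := by
    rw [← coe_value hM]
    exact EReal.coe_lt_coe_iff.2 (by linarith)
  obtain ⟨σ, hσ⟩ := lt_iSup_iff.1 h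
  exact ⟨σ, (EReal.coe_lt_coe_iff.1 hσ).le⟩

lemma integrable_state {v : S → ℝ} (hv : ∃ m, ∀ s, |v s| ≤ m) (μ : Measure (ℕ → S))
    [IsFiniteMeasure μ] (n : ℕ) : Integrable (fun ω => v (ω n)) μ := by
  obtain ⟨m, hm⟩ := hv
  exact Integrable.of_bound
    ((measurable_of_countable v).comp (measurable_pi_apply n)).aestronglyMeasurable m
    (Eventually.of_forall fun ω => hm _)

lemma setIntegral_cyl_state (v : S → ℝ) (μ : Measure (ℕ → S)) (f : ℕ → S) (n : ℕ) :
    ∫ ω in cyl f n, v (ω n) ∂μ = μ.real (cyl f n) * v (f n) := by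
  rw [setIntegral_congr_fun (g := fun _ => v (f n)) (measurableSet_cyl f n)
    fun ω hω => by rw [hω n le_rfl], setIntegral_const, smul_eq_mul]

lemma setIntegral_cyl_payoff (M : MDP S) (k : PayoffKind) (σ : M.Strategy) (s : S) (f : ℕ → S)
    (n : ℕ) : ∫ ω in cyl f n, (M.payoff k ω).toReal ∂σ.runMeasure s =
      (σ.runMeasure s).real (cyl f n) * M.expectedPayoff k (f n) (σ.after (past f n)) := by
  rw [expectedPayoff, ← setIntegral_cyl_shift σ s f n (M.measurable_toReal_payoff k)]
  simp only [payoff_shift]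

/-- The expected value of the state at time `n` is at most the value of the initial state. -/
lemma integral_value_le {M : MDP S} (hM : M.BoundedRewards) (k : PayoffKind) (σ : M.Strategy)
    (s : S) (n : ℕ) : ∫ ω, M.value k (ω n) ∂σ.runMeasure s ≤ M.value k s := by
  refine le_of_forall_pos_le_add fun ε hε => ?_
  -- Following `σ` up to time `n` and then an ε-optimal strategy from the state reached earns at
  -- least the mean value at time `n` minus ε, and no strategy earns more than the value of `s`.
  choose ρ hρ using fun s => exists_value_sub_le hM k s hε
  have hv := exists_abs_value_le hM k
  have h1 : ∫ ω, (M.value k (ω n) - ε) ∂(σ.switch n ρ).runMeasure s ≤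
      M.expectedPayoff k s (σ.switch n ρ) := by
    have hi : Integrable (fun ω => M.value k (ω n) - ε) ((σ.switch n ρ).runMeasure s) :=
      (integrable_state hv _ n).sub (integrable_const ε)
    have := setIntegral_mono_of_cyl (n := n) hi (integrable_payoff hM k _ s) (fun f => ?_) Set.univ
    · simpa [expectedPayoff] using this
    · rw [setIntegral_cyl_payoff, setIntegral_cyl_state (fun s => M.value k s - ε)]
      refine mul_le_mul_of_nonneg_left ?_ measureReal_nonneg
      rw [expectedPayoff, after_switch_runMeasure]
      exact hρ _
  rw [integral_sub (integrable_state hv _ n) (integrable_const ε),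
    integral_state_congr (switch_runMeasure_cyl σ s n ρ) (M.value k)] at h1
  have h2 := expectedPayoff_le_value hM k s (σ.switch n ρ)
  simp only [integral_const, probReal_univ, one_smul] at h1
  linarith

/-- Under an optimal strategy, the value of the state at time `n` has the same integrals as the
payoff over the events that depend on the first `n + 1` states. -/
lemma IsExpectedOptimal.setIntegral_value {M : MDP S} (hM : M.BoundedRewards) {k : PayoffKind}
    {s : S} {σ : M.Strategy} (h : M.IsExpectedOptimal k s σ) (n : ℕ) (B : Set (Finset.Iic n → S)) :
    ∫ ω in Preorder.frestrictLe (π := fun _ => S) n ⁻¹' B, M.value k (ω n) ∂σ.runMeasure s =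
      ∫ ω in Preorder.frestrictLe (π := fun _ => S) n ⁻¹' B,
        (M.payoff k ω).toReal ∂σ.runMeasure s := by
  have hv := integrable_state (exists_abs_value_le hM k) (σ.runMeasure s) n
  have hp := integrable_payoff hM k σ s
  have hle := setIntegral_mono_of_cyl hp hv fun f => by
    rw [setIntegral_cyl_payoff, setIntegral_cyl_state]
    exact mul_le_mul_of_nonneg_left (expectedPayoff_le_value hM k _ _) measureReal_nonneg
  have hB : MeasurableSet (Preorder.frestrictLe (π := fun _ => S) n ⁻¹' B) :=
    Preorder.measurable_frestrictLe n B.to_countable.measurableSet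
  -- The inequality holds on `B` and on its complement, while optimality and `integral_value_le`
  -- reverse it for the sum; hence both are equalities.
  have h1 := hle B
  have h2 := hle Bᶜ
  rw [Set.preimage_compl] at h2
  have h3 := integral_add_compl hB hv
  have h4 := integral_add_compl hB hp
  have h5 := integral_value_le hM k σ s n
  have h6 : M.value k s ≤ ∫ ω, (M.payoff k ω).toReal ∂σ.runMeasure s :=
    (isExpectedOptimal_iff hM).1 h
  linarith

lemma IsExpectedOptimal.setIntegral_cyl_value {M : MDP S} (hM : M.BoundedRewards)
    {k : PayoffKind} {s : S} {σ : M.Strategy} (h : M.IsExpectedOptimal k s σ) (n : ℕ)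
    (f : ℕ → S) : ∫ ω in cyl f n, M.value k (ω n) ∂σ.runMeasure s =
      ∫ ω in cyl f n, (M.payoff k ω).toReal ∂σ.runMeasure s := by
  rw [cyl_eq_preimage]
  exact h.setIntegral_value hM n _

lemma IsExpectedOptimal.integral_value {M : MDP S} (hM : M.BoundedRewards) {k : PayoffKind}
    {s : S} {σ : M.Strategy} (h : M.IsExpectedOptimal k s σ) (n : ℕ) :
    ∫ ω, M.value k (ω n) ∂σ.runMeasure s = M.value k s := by
  have := h.setIntegral_value hM n Set.univ
  rw [← h.eq_value hM, expectedPayoff]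
  simpa using this

/-- An optimal strategy is optimal after every partial run of positive probability. -/
lemma IsExpectedOptimal.after {M : MDP S} (hM : M.BoundedRewards) {k : PayoffKind}
    {s : S} {σ : M.Strategy} (h : M.IsExpectedOptimal k s σ) {n : ℕ} {f : ℕ → S}
    (hf : σ.runMeasure s (cyl f n) ≠ 0) : M.IsExpectedOptimal k (f n) (σ.after (past f n)) := by
  have := h.setIntegral_cyl_value hM n f
  rw [setIntegral_cyl_payoff, setIntegral_cyl_state] at this
  refine (isExpectedOptimal_iff hM).2 (mul_left_cancel₀ ?_ this).le
  exact (measureReal_ne_zero_iff (measure_ne_top _ _)).2 hf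

/-- The run measure of a one-step partial run. -/
lemma runMeasure_cyl_one {M : MDP S} (σ : M.Strategy) (s : S) (f : ℕ → S) (hf : f 0 = s) :
    σ.runMeasure s (cyl f 1) = σ.next [] s (f 1) := by
  rw [runMeasure_cyl_succ, runMeasure_cyl_zero, if_pos hf, one_mul, hf]
  rfl

/-- The value does not increase along the transitions of controlled states. -/
lemma value_le_of_step {M : MDP S} (hM : M.BoundedRewards) (k : PayoffKind) {s s' : S}
    (hs : s ∈ M.controlled) (h : M.step s s') : M.value k s' ≤ M.value k s := by
  classical
  obtain ⟨σ₀⟩ : Nonempty M.Strategy := inferInstance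
  -- Always choosing `s'` at `s` makes the mean value at time 1 equal to that of `s'`, which
  -- `integral_value_le` bounds.
  let σ : M.Strategy :=
    { act := fun w t => if t = ⟨s, hs⟩ then PMF.pure s' else σ₀.act w t
      step_of_act := fun w t t' ht => by
        split_ifs at ht with e
        · rw [PMF.pure_apply] at ht
          split_ifs at ht with e'
          · rw [e, e']; exact h
          · exact absurd rfl ht
        · exact σ₀.step_of_act _ _ _ ht }
  have h1 : (fun ω => M.value k (ω 1)) =ᵐ[σ.runMeasure s] fun _ => M.value k s' := by
    filter_upwards [ae_next_ne_zero σ s] with ω ⟨h0, h⟩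
    have := (h 0).2
    rw [h0] at this
    have e : σ.next (past ω 0) s = PMF.pure s' := by simp [Strategy.next, hs, σ]
    rw [e, PMF.pure_apply] at this
    rw [of_not_not fun hne => this (if_neg hne)]
  have h2 := integral_value_le hM k σ s 1
  rw [integral_congr_ae h1] at h2
  simpa using h2

/-! ### Optimal states and optimal transitions -/

/-- The states from which an optimal strategy for the expected payoff exists. -/
def optimalStates (M : MDP S) (k : PayoffKind) : Set S :=
  {s | ∃ σ, M.IsExpectedOptimal k s σ}

/-- The transitions that optimal strategies may use. -/
def optimalStep (M : MDP S) (k : PayoffKind) (s s' : S) : Prop :=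
  -- Random states preserve the value only on average, so equality is asked of controlled ones
  -- alone. States that are not optimal keep all transitions, and thus a successor.
  M.step s s' ∧ (s ∈ M.optimalStates k →
    s' ∈ M.optimalStates k ∧ (s ∈ M.controlled → M.value k s' = M.value k s))

lemma IsExpectedOptimal.optimalStep_of_next_nil {M : MDP S} (hM : M.BoundedRewards)
    {k : PayoffKind} {s s' : S} {σ : M.Strategy} (h : M.IsExpectedOptimal k s σ)
    (hn : σ.next [] s s' ≠ 0) : M.optimalStep k s s' := by
  obtain ⟨f, hf0, hf1⟩ : ∃ f : ℕ → S, f 0 = s ∧ f 1 = s' :=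
    ⟨fun i => if i = 0 then s else s', rfl, rfl⟩
  have hpos : σ.runMeasure s (cyl f 1) ≠ 0 := by
    rwa [runMeasure_cyl_one _ _ _ hf0, hf1]
  refine ⟨σ.step_of_next hn, fun _ => ⟨⟨_, hf1 ▸ h.after hM hpos⟩, fun hs => ?_⟩⟩
  have hle : ∀ᵐ ω ∂σ.runMeasure s, M.value k (ω 1) ≤ M.value k s := by
    filter_upwards [ae_next_ne_zero σ s] with ω ⟨h0, h⟩
    have := (h 0).2
    rw [h0] at this
    exact value_le_of_step hM k hs (σ.step_of_next this)
  have hi := integrable_state (exists_abs_value_le hM k) (σ.runMeasure s) 1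
  -- The value at time 1 is almost surely at most that of `s` and has the same mean, so it is almost
  -- surely equal; a transition of positive probability cannot be an exception.
  have heq := (integral_eq_iff_of_ae_le hi (integrable_const _) hle).1
    (by simpa using h.integral_value hM 1)
  by_contra hne
  refine hpos (measure_mono_null (fun ω hω => ?_) (ae_iff.1 heq))
  have : ω 1 = s' := (hω 1 le_rfl).trans hf1
  simpa [this] using hne

lemma IsExpectedOptimal.optimalStep_of_next {M : MDP S} (hM : M.BoundedRewards)
    {k : PayoffKind} {s s' : S} {σ : M.Strategy} (h : M.IsExpectedOptimal k s σ) {f : ℕ → S}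
    {n : ℕ} (hf : σ.runMeasure s (cyl f n) ≠ 0) (hn : σ.next (past f n) (f n) s' ≠ 0) :
    M.optimalStep k (f n) s' :=
  (h.after hM hf).optimalStep_of_next_nil hM (by rwa [Strategy.next_after, List.append_nil])

/-- At an optimal state, the first moves of an optimal strategy survive; at a random one these
include all moves of positive probability. -/
lemma isSubStep_optimalStep {M : MDP S} (hM : M.BoundedRewards) (k : PayoffKind) :
    M.IsSubStep (M.optimalStep k) where
  step_of _ _ h := h.1
  exists_step s := by
    by_cases hs : s ∈ M.optimalStates k
    · obtain ⟨σ, hσ⟩ := id hs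
      obtain ⟨s', hs'⟩ := (σ.next [] s).support_nonempty
      exact ⟨s', hσ.optimalStep_of_next_nil hM ((PMF.mem_support_iff _ _).1 hs')⟩
    · obtain ⟨s', hs'⟩ := M.exists_step s
      exact ⟨s', hs', fun h => absurd h hs⟩
  of_prob s s' h := by
    refine ⟨M.step_of_prob s s' h, fun hs => ?_⟩
    obtain ⟨σ, hσ⟩ := id hs
    have : σ.next [] s s' ≠ 0 := by rwa [Strategy.next, dif_neg s.2]
    exact (hσ.optimalStep_of_next_nil hM this).2 hs

/-- From an optimal state, the value is preserved on average in one step. -/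
lemma integral_value_one {M : MDP S} (hM : M.BoundedRewards) {k : PayoffKind} {s : S}
    (hs : s ∈ M.optimalStates k) (σ : M.Strategy)
    (hσ : ∀ s', σ.next [] s s' ≠ 0 → M.optimalStep k s s') :
    ∫ ω, M.value k (ω 1) ∂σ.runMeasure s = M.value k s := by
  by_cases hc : s ∈ M.controlled
  · have h1 : (fun ω => M.value k (ω 1)) =ᵐ[σ.runMeasure s] fun _ => M.value k s := by
      filter_upwards [ae_next_ne_zero σ s] with ω ⟨h0, h⟩
      have := (h 0).2
      rw [h0] at this
      exact ((hσ _ this).2 hs).2 hc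
    rw [integral_congr_ae h1]
    simp
  · obtain ⟨σ', hσ'⟩ := id hs
    rw [← hσ'.integral_value hM 1]
    -- At a random state the first step does not depend on the strategy, so an optimal one may
    -- replace `σ`.
    refine integral_state_congr (runMeasure_cyl_congr fun f m hm hf => ?_) _
    obtain rfl : m = 0 := by omega
    rw [eq_of_runMeasure_cyl_ne_zero hf, Strategy.next, Strategy.next, dif_neg hc, dif_neg hc]

end Measure

/-! ### Martingale convergence of the values -/

section Measure

variable [Countable S] [MeasurableSpace S] [DiscreteMeasurableSpace S]

omit [Countable S] [DiscreteMeasurableSpace S] in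
lemma measurable_eval_piLE (n : ℕ) :
    Measurable[Filtration.piLE (X := fun _ => S) n] fun ω : ℕ → S => ω n := by
  rw [Filtration.piLE_eq_comap_frestrictLe]
  exact (measurable_pi_apply (X := fun _ : Finset.Iic n => S) ⟨n, by simp⟩).comp
    (comap_measurable (Preorder.frestrictLe (π := fun _ => S) n))

omit [Countable S] [DiscreteMeasurableSpace S] in
lemma pi_le_iSup_piLE :
    (MeasurableSpace.pi : MeasurableSpace (ℕ → S)) ≤ ⨆ n, Filtration.piLE (X := fun _ => S) n :=
  iSup_le fun n => (measurable_iff_comap_le.1 (measurable_eval_piLE n)).trans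
    (le_iSup (fun n => Filtration.piLE (X := fun _ => S) n) n)

/-- Under an optimal strategy, the values of the states converge to the payoff. -/
lemma IsExpectedOptimal.ae_tendsto_value {M : MDP S} (hM : M.BoundedRewards) {k : PayoffKind}
    {s : S} {σ : M.Strategy} (h : M.IsExpectedOptimal k s σ) :
    ∀ᵐ ω ∂σ.runMeasure s,
      Tendsto (fun n => M.value k (ω n)) atTop (nhds (M.payoff k ω).toReal) := by
  have hp := integrable_payoff hM k σ s
  have h1 := fun n => condExp_piLE_ae_eq hp
    (integrable_state (exists_abs_value_le hM k) (σ.runMeasure s) n)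
    (h.setIntegral_cyl_value hM n)
  -- Lévy's upward theorem: the payoff is measurable for the σ-algebra generated by all finite
  -- histories.
  have h2 := hp.tendsto_ae_condExp (ℱ := Filtration.piLE (X := fun _ => S))
    ((M.measurable_toReal_payoff k).stronglyMeasurable.mono pi_le_iSup_piLE)
  filter_upwards [ae_all_iff.2 h1, h2] with ω h1 h2
  exact h2.congr fun n => (h1 n).symm

/-- The strategy `σ` uses from `s` only the transitions of `T`. -/
def Strategy.Uses {M : MDP S} (σ : M.Strategy) (T : S → S → Prop) (s : S) : Prop :=
  ∀ f n s', σ.runMeasure s (cyl f n) ≠ 0 → σ.next (past f n) (f n) s' ≠ 0 → T (f n) s'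

lemma Strategy.Uses.mem_optimalStates {M : MDP S} {k : PayoffKind} {s : S} {σ : M.Strategy}
    (h : σ.Uses (M.optimalStep k) s) (hs : s ∈ M.optimalStates k) {f : ℕ → S} {n : ℕ}
    (hf : σ.runMeasure s (cyl f n) ≠ 0) : f n ∈ M.optimalStates k := by
  induction n with
  | zero => rwa [eq_of_runMeasure_cyl_ne_zero hf]
  | succ n ih =>
    rw [runMeasure_cyl_succ] at hf
    have h0 := left_ne_zero_of_mul hf
    exact ((h f n _ h0 (right_ne_zero_of_mul hf)).2 (ih h0)).1

/-- Along optimal transitions, the values of the states form a martingale. -/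
lemma Strategy.Uses.setIntegral_cyl_value_succ {M : MDP S} (hM : M.BoundedRewards)
    {k : PayoffKind} {s : S} {σ : M.Strategy} (h : σ.Uses (M.optimalStep k) s)
    (hs : s ∈ M.optimalStates k) (n : ℕ) (f : ℕ → S) :
    ∫ ω in cyl f n, M.value k (ω n) ∂σ.runMeasure s =
      ∫ ω in cyl f n, M.value k (ω (n + 1)) ∂σ.runMeasure s := by
  rw [setIntegral_cyl_state]
  have e := setIntegral_cyl_shift σ s f n (F := fun ω => M.value k (ω 1))
    ((measurable_of_countable (M.value k)).comp (measurable_pi_apply 1))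
  refine Eq.trans ?_ e.symm
  by_cases hf : σ.runMeasure s (cyl f n) = 0
  · simp [measureReal_def, hf]
  · rw [integral_value_one hM (h.mem_optimalStates hs hf)]
    intro s' hs'
    rw [Strategy.next_after, List.append_nil] at hs'
    exact h f n s' hf hs'

/-- The values are a bounded martingale: they converge almost surely, and dominated convergence
passes their constant mean to the limit. -/
lemma Strategy.Uses.exists_ae_tendsto_value {M : MDP S} (hM : M.BoundedRewards)
    {k : PayoffKind} {s : S} {σ : M.Strategy} (h : σ.Uses (M.optimalStep k) s)
    (hs : s ∈ M.optimalStates k) :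
    ∃ l : (ℕ → S) → ℝ, Integrable l (σ.runMeasure s) ∧
      (∀ᵐ ω ∂σ.runMeasure s, Tendsto (fun n => M.value k (ω n)) atTop (nhds (l ω))) ∧
      ∫ ω, l ω ∂σ.runMeasure s = M.value k s := by
  have hv := exists_abs_value_le hM k
  obtain ⟨m, hm⟩ := id hv
  have hi := fun n => integrable_state hv (σ.runMeasure s) n
  have hcyl := h.setIntegral_cyl_value_succ hM hs
  have hmart : Martingale (fun n (ω : ℕ → S) => M.value k (ω n))
      (Filtration.piLE (X := fun _ => S)) (σ.runMeasure s) := by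
    refine martingale_nat (fun n => ?_) hi
      fun n => condExp_piLE_ae_eq (hi (n + 1)) (hi n) (hcyl n)
    exact ((measurable_of_countable (M.value k)).comp (measurable_eval_piLE n)).stronglyMeasurable
  have hb : ∀ n, eLpNorm (fun ω : ℕ → S => M.value k (ω n)) 1 (σ.runMeasure s) ≤
      (m.toNNReal : ℝ≥0∞) := fun n => by
    have := eLpNorm_le_of_ae_bound (p := 1) (μ := σ.runMeasure s)
      (f := fun ω : ℕ → S => M.value k (ω n)) (C := m) (Eventually.of_forall fun ω => hm _)
    simpa [ENNReal.ofReal] using this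
  have hconv := hmart.submartingale.ae_tendsto_limitProcess hb
  refine ⟨_, (memLp_one_iff_integrable.1 (hmart.submartingale.memLp_limitProcess hb)), hconv, ?_⟩
  have hint : ∀ n, ∫ ω, M.value k (ω n) ∂σ.runMeasure s = M.value k s := fun n => by
    induction n with
    | zero =>
      have : (fun ω : ℕ → S => M.value k (ω 0)) =ᵐ[σ.runMeasure s] fun _ => M.value k s := by
        filter_upwards [ae_next_ne_zero σ s] with ω hω
        rw [hω.1]
      rw [integral_congr_ae this]
      simp
    | succ n ih =>
      have := setIntegral_congr_of_cyl (hi n) (hi (n + 1)) (hcyl n) Set.univ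
      rw [← ih]
      simpa using this.symm
  have hlim := tendsto_integral_of_dominated_convergence (fun _ => m)
    (fun n => (hi n).aestronglyMeasurable) (integrable_const m)
    (fun n => Eventually.of_forall fun ω => hm (ω n)) hconv
  simp only [hint] at hlim
  exact tendsto_nhds_unique hlim tendsto_const_nhds

/-- If the strategy uses only optimal transitions and the payoff dominates almost surely the limit
of the values of the states, then the strategy is optimal. -/
lemma Strategy.Uses.isExpectedOptimal {M : MDP S} (hM : M.BoundedRewards)
    {k : PayoffKind} {s : S} {σ : M.Strategy} (h : σ.Uses (M.optimalStep k) s)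
    (hs : s ∈ M.optimalStates k)
    (hp : ∀ᵐ ω ∂σ.runMeasure s, ∀ l : ℝ, Tendsto (fun n => M.value k (ω n)) atTop (nhds l) →
      l ≤ (M.payoff k ω).toReal) : M.IsExpectedOptimal k s σ := by
  obtain ⟨l, hl, hconv, hint⟩ := h.exists_ae_tendsto_value hM hs
  rw [isExpectedOptimal_iff hM, ← hint]
  refine integral_mono_ae hl (integrable_payoff hM k σ s) ?_
  filter_upwards [hconv, hp] with ω h1 h2
  exact h2 _ h1

/-! ### Transfer between the two objectives -/

/-- The sub-MDP of the optimal transitions, with the rewards diminished by the values. -/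
noncomputable def optimalMDP (M : MDP S) (hM : M.BoundedRewards) (k : PayoffKind) : MDP S :=
  M.restrict (M.optimalStep k) (isSubStep_optimalStep hM k) fun s s' => M.reward s s' - M.value k s

lemma measurableSet_nonneg_payoff (M : MDP S) (k : PayoffKind) :
    MeasurableSet {ω | 0 ≤ M.payoff k ω} :=
  measurableSet_le measurable_const (M.measurable_payoff k)

lemma runMeasure_lift {M : MDP S} {T : S → S → Prop} {hT : M.IsSubStep T} {u : S → S → ℝ}
    (τ : (M.restrict T hT u).Strategy) (s : S) : τ.lift.runMeasure s = τ.runMeasure s :=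
  runMeasure_congr fun _ _ _ => rfl

/-- An optimal strategy for the expected payoff yields an almost surely winning strategy for the
threshold objective in the MDP of the optimal transitions. -/
lemma IsExpectedOptimal.exists_thresholdProb_eq_one {M : MDP S} (hM : M.BoundedRewards)
    {k : PayoffKind} {s : S} {σ : M.Strategy} (h : M.IsExpectedOptimal k s σ) :
    ∃ τ, (M.optimalMDP hM k).thresholdProb k s τ = 1 := by
  classical
  have hT := isSubStep_optimalStep hM k
  -- `σ` may choose other transitions after partial runs of probability zero. Replacing such choices
  -- by arbitrary optimal transitions leaves the law of the run unchanged.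
  let τ : (M.optimalMDP hM k).Strategy :=
    { act := fun w t => if ∀ s', σ.act w t s' ≠ 0 → M.optimalStep k t s' then σ.act w t else
        PMF.pure (hT.exists_step t).choose
      step_of_act := fun w t s' ht => by
        split_ifs at ht with e
        · exact e s' ht
        · rw [PMF.pure_apply] at ht
          split_ifs at ht with e'
          · exact e' ▸ (hT.exists_step t).choose_spec
          · exact absurd rfl ht }
  have hτ : σ.runMeasure s = τ.runMeasure s := by
    refine runMeasure_congr fun f n hf => ?_
    by_cases hc : f n ∈ M.controlled
    · have hc' : f n ∈ (M.optimalMDP hM k).controlled := hc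
      rw [Strategy.next, Strategy.next, dif_pos hc, dif_pos hc']
      refine (if_pos fun s' hs' => h.optimalStep_of_next hM hf ?_).symm
      rwa [Strategy.next, dif_pos hc]
    · have hc' : f n ∉ (M.optimalMDP hM k).controlled := hc
      rw [Strategy.next, Strategy.next, dif_neg hc, dif_neg hc']
      rfl
  refine ⟨τ, ?_⟩
  rw [thresholdProb, ← hτ, prob_compl_eq_zero_iff (measurableSet_nonneg_payoff _ k) |>.symm]
  obtain ⟨m, hm⟩ := id hM
  refine ae_iff.1 ?_
  filter_upwards [h.ae_tendsto_value hM, ae_reward_le hm σ s] with ω h1 h2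
  have h3 := payoff_sub_add (M := M) (N := M.optimalMDP hM k) k (fun _ _ => rfl) h1
  rw [M.coe_toReal_payoff k h2] at h3
  by_contra hneg
  rw [← M.coe_toReal_payoff k h2] at h3
  -- The payoff in `M` is finite, so adding it preserves the strict inequality in `EReal`.
  have h4 := EReal.add_lt_add_right_coe (not_le.1 hneg) (M.payoff k ω).toReal
  rw [h3, zero_add] at h4
  exact lt_irrefl _ h4

/-- Optimal strategies for the threshold objective in the MDP of the optimal transitions are
optimal for the expected payoff. -/
lemma IsThresholdOptimal.isExpectedOptimal_lift {M : MDP S} (hM : M.BoundedRewards)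
    {k : PayoffKind} {s : S} (hs : s ∈ M.optimalStates k)
    {τ : (M.restrict (M.optimalStep k) (isSubStep_optimalStep hM k)
      fun s s' => M.reward s s' - M.value k s).Strategy}
    (hτ : IsThresholdOptimal _ k s τ) : M.IsExpectedOptimal k s τ.lift := by
  obtain ⟨σ, hσ⟩ := id hs
  obtain ⟨τ₁, hτ₁⟩ := hσ.exists_thresholdProb_eq_one hM
  -- Some strategy wins with probability one, so an optimal one does too.
  have hone : τ.runMeasure s {ω | 0 ≤ (M.optimalMDP hM k).payoff k ω} = 1 :=
    prob_le_one.antisymm <| hτ₁.symm.le.trans <|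
      (le_iSup (fun τ => (M.optimalMDP hM k).thresholdProb k s τ) τ₁).trans hτ
  have hae := (prob_compl_eq_zero_iff (measurableSet_nonneg_payoff _ k)).2 hone
  rw [← runMeasure_lift] at hae
  have huses : τ.lift.Uses (M.optimalStep k) s := fun f n s' _ hn =>
    Strategy.step_of_next τ (w := past f n) hn
  refine huses.isExpectedOptimal hM hs ?_
  obtain ⟨m, hm⟩ := id hM
  filter_upwards [ae_reward_le hm τ.lift s, show ∀ᵐ ω ∂τ.lift.runMeasure s,
    0 ≤ (M.optimalMDP hM k).payoff k ω from hae] with ω h1 h2 l hl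
  have h3 := payoff_sub_add (M := M) (N := M.optimalMDP hM k) k (fun _ _ => rfl) hl
  rw [← EReal.coe_le_coe_iff, M.coe_toReal_payoff k h1, ← h3]
  exact le_add_of_nonneg_left h2

end Measure

/-! ### Strategy classes and the main theorem -/

/-- An implementation in a sub-MDP, regarded as an implementation in the MDP. -/
def Implementation.lift {M : MDP S} {T : S → S → Prop} {hT : M.IsSubStep T} {u : S → S → ℝ}
    {X : MemoryType} (ι : (M.restrict T hT u).Implementation X) : M.Implementation X where
  init := ι.init
  init_mem := ι.init_mem
  trans := ι.trans
  move_of_trans := ι.move_of_trans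
  step_of_trans m s m' s' hs h := hT.step_of _ _ (ι.step_of_trans m s m' s' hs h)
  tsum_trans := ι.tsum_trans

lemma Implementation.weight_lift {M : MDP S} {T : S → S → Prop} {hT : M.IsSubStep T}
    {u : S → S → ℝ} {X : MemoryType} (ι : (M.restrict T hT u).Implementation X) (ω : ℕ → S)
    (n : ℕ) (m : X.Mode) : ι.lift.weight ω n m = ι.weight ω n m := by
  induction n generalizing m with
  | zero => rfl
  | succ n ih => simp only [Implementation.weight, ih]; rfl

/-- Lifting changes neither the choices nor the memory updates, so determinism and the memory type
survive. -/
lemma StrategyClass.Contains.lift {C : StrategyClass} {M : MDP S} {T : S → S → Prop}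
    {hT : M.IsSubStep T} {u : S → S → ℝ} {s₀ : S} {τ : (M.restrict T hT u).Strategy}
    (h : C.Contains s₀ τ) : C.Contains s₀ τ.lift := by
  obtain ⟨hd, X, hX, ι, hι⟩ := h
  refine ⟨hd, X, hX, ι.lift, fun ω h0 n hn s' => ?_⟩
  simp only [Implementation.weight_lift]
  exact hι ω h0 n hn s'

end MDP

theorem mainTheorem4 {S : Type*} [Countable S] [MeasurableSpace S] [DiscreteMeasurableSpace S]
    (k : MDP.PayoffKind) :
    (∀ (M : MDP S) (s₀ : S), M.BoundedRewards → (∃ σ, M.IsExpectedOptimal k s₀ σ) →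
      ∃ (T : S → S → Prop) (hT : M.IsSubStep T) (u : S → S → ℝ),
        (∃ τ, (M.restrict T hT u).IsThresholdOptimal k s₀ τ) ∧
        (∀ τ, (M.restrict T hT u).IsThresholdOptimal k s₀ τ → M.IsExpectedOptimal k s₀ τ.lift) ∧
        (∀ C : MDP.StrategyClass,
          (∃ τ, C.Contains s₀ τ ∧ (M.restrict T hT u).IsThresholdOptimal k s₀ τ) →
            ∃ σ, C.Contains s₀ σ ∧ M.IsExpectedOptimal k s₀ σ)) ∧
    (∀ C : MDP.StrategyClass,
      (∀ (N : MDP S) (s₀ : S), (∃ τ, N.IsThresholdOptimal k s₀ τ) →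
        ∃ τ, C.Contains s₀ τ ∧ N.IsThresholdOptimal k s₀ τ) →
      ∀ (M : MDP S) (s₀ : S), M.BoundedRewards → (∃ σ, M.IsExpectedOptimal k s₀ σ) →
        ∃ σ, C.Contains s₀ σ ∧ M.IsExpectedOptimal k s₀ σ) := by
  have key : ∀ (M : MDP S) (s₀ : S) (hM : M.BoundedRewards),
      (∃ σ, M.IsExpectedOptimal k s₀ σ) →
        ∃ τ, (M.optimalMDP hM k).IsThresholdOptimal k s₀ τ := by
    rintro M s₀ hM ⟨σ, hσ⟩
    obtain ⟨τ, hτ⟩ := hσ.exists_thresholdProb_eq_one hM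
    exact ⟨τ, (iSup_le fun _ => prob_le_one).trans hτ.ge⟩
  refine ⟨fun M s₀ hM hs => ⟨_, MDP.isSubStep_optimalStep hM k, _, key M s₀ hM hs,
    fun τ hτ => hτ.isExpectedOptimal_lift hM hs, ?_⟩, fun C hC M s₀ hM hs => ?_⟩
  · rintro C ⟨τ, hτC, hτ⟩
    exact ⟨τ.lift, hτC.lift, hτ.isExpectedOptimal_lift hM hs⟩
  · obtain ⟨τ, hτC, hτ⟩ := hC _ s₀ (key M s₀ hM hs)
    exact ⟨MDP.Strategy.lift τ, hτC.lift, hτ.isExpectedOptimal_lift hM hs⟩
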